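/- Let $\{B(s):s\in\mathbb{R}\}$ be a standard two-sided Wiener process (that is, $\{B(t)\}_{t\ge0}$ and $\{B(-t)\}_{t\ge0}$ are independent standard Brownian motions started at $0$ with almost surely continuous paths). For $n\in\{0,1,2,\dots\}$, $H\in(0,1)$ and $t\ge0$ put $$g^{(n)}_H(t,s):=\frac{\partial^n}{\partial H^n}(t-s)^{H-\frac12}=\log^n(t-s)\,(t-s)^{H-\frac12}\quad(s<t),$$ $$f^{(n)}_H(t,s):=\frac{\partial^n}{\partial H^n}\Big[(t-s)^{H-\frac12}-(-s)^{H-\frac12}\Big]=\log^n(t-s)\,(t-s)^{H-\frac12}-\log^n(-s)\,(-s)^{H-\frac12}\quad(s<0),$$ and let the Paley-Wiener-Zygmund (PWZ) field ($n=0$) and its derivative fields ($n\ge1$) be $$\tilde X^{(n)}_H(t):=-\int_{-\infty}^0\Big[\frac{\partial}{\partial s}f^{(n)}_H(t,s)\Big]B(s)\,ds+g^{(n)}_H(t,0)B(t)+\int_0^t\Big[\frac{\partial}{\partial s}g^{(n)}_H(t,s)\Big]\big(B(t)-B(s)\big)\,ds,$$ where for $t=0$ the middle term is read as $0$ when $B(0)=0$.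 Proposition. (i) For every $n\ge0$, almost surely, the two integrals defining $\tilde X^{(n)}_H(t)$ converge absolutely simultaneously for all $(H,t)\in(0,1)\times[0,\infty)$. (ii) For every $n\ge0$, almost surely, simultaneously for all $(H,t)\in(0,1)\times[0,\infty)$, $$\lim_{\Delta\to0}\frac{\tilde X^{(n)}_{H+\Delta}(t)-\tilde X^{(n)}_H(t)}{\Delta}=\tilde X^{(n+1)}_H(t).$$ (iii) Consequently, almost surely, for every $t\ge0$ the function $H\mapsto\tilde X^{(0)}_H(t)$ is infinitely differentiable on $(0,1)$, and $\frac{\partial^n}{\partial H^n}\tilde X^{(0)}_H(t)=\tilde X^{(n)}_H(t)$ for all $n\ge0$ and all $H\in(0,1)$. -/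

import Mathlib

open MeasureTheory ProbabilityTheory Set Filter Topology
open scoped NNReal

/-- A standard two-sided Wiener process `B : ℝ → Ω → ℝ`: its forward part `t ↦ B t` and its
backward part `t ↦ B (-t)`, for `t ≥ 0`, are independent standard Brownian motions
(started at `0`, with almost surely continuous paths). -/
structure IsTwoSidedWiener {Ω : Type*} [MeasurableSpace Ω] (B : ℝ → Ω → ℝ) (P : Measure Ω) :
    Prop where
  forward : IsBrownianReal (fun t : ℝ≥0 => B (t : ℝ)) P
  backward : IsBrownianReal (fun t : ℝ≥0 => B (-(t : ℝ))) P
  indep : IndepFun (fun ω (t : ℝ≥0) => B (t : ℝ) ω) (fun ω (t : ℝ≥0) => B (-(t : ℝ)) ω) P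

/-- `g_H^{(n)}(t,s) = log^n(t-s) (t-s)^{H-1/2}`, the `n`-th `H`-derivative of the kernel
`g_H(t,s) = (t-s)^{H-1/2}`, for `s < t`. -/
noncomputable def kernelG (n : ℕ) (H t s : ℝ) : ℝ :=
  Real.log (t - s) ^ n * (t - s) ^ (H - 1 / 2)

/-- `f_H^{(n)}(t,s) = log^n(t-s) (t-s)^{H-1/2} - log^n(-s) (-s)^{H-1/2}`, the `n`-th
`H`-derivative of the kernel `f_H(t,s) = (t-s)^{H-1/2} - (-s)^{H-1/2}`, for `s < 0 ≤ t`. -/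
noncomputable def kernelF (n : ℕ) (H t s : ℝ) : ℝ :=
  Real.log (t - s) ^ n * (t - s) ^ (H - 1 / 2) - Real.log (-s) ^ n * (-s) ^ (H - 1 / 2)

/-- The Paley-Wiener-Zygmund field and its derivative fields:
`X̃^{(n)}_H(t) = -∫_{-∞}^0 [∂_s f_H^{(n)}(t,s)] B(s) ds + g_H^{(n)}(t,0) B(t)
  + ∫_0^t [∂_s g_H^{(n)}(t,s)] (B(t) - B(s)) ds`. -/
noncomputable def pwzField {Ω : Type*} (B : ℝ → Ω → ℝ) (n : ℕ) (H t : ℝ) (ω : Ω) : ℝ :=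
  -(∫ s in Iio (0 : ℝ), deriv (fun u => kernelF n H t u) s * B s ω)
    + kernelG n H t 0 * B t ω
    + ∫ s in (0 : ℝ)..t, deriv (fun u => kernelG n H t u) s * (B t ω - B s ω)

/-- The integrals that define `pwzField B n H t ω` converge absolutely. -/
def PwzWellDefined {Ω : Type*} (B : ℝ → Ω → ℝ) (n : ℕ) (H t : ℝ) (ω : Ω) : Prop :=
  IntegrableOn (fun s => deriv (fun u => kernelF n H t u) s * B s ω) (Iio (0 : ℝ)) volume ∧
    IntervalIntegrable (fun s => deriv (fun u => kernelG n H t u) s * (B t ω - B s ω)) volume 0 t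

/-- `g_H^{(n+1)} = ∂_H g_H^{(n)}`. -/
theorem hasDerivAt_kernelG_hurst (n : ℕ) (H : ℝ) {t s : ℝ} (hs : s < t) :
    HasDerivAt (fun h => kernelG n h t s) (kernelG (n + 1) H t s) H := by
  have h0 : 0 < t - s := sub_pos.2 hs
  have h1 := (((hasDerivAt_id H).sub_const (1 / 2 : ℝ)).const_rpow h0).const_mul
    (Real.log (t - s) ^ n)
  refine h1.congr_deriv ?_
  simp only [kernelG, id]
  ring

/-- `g_H^{(n)} = ∂_H^n g_H`. -/
theorem kernelG_eq_iteratedDeriv (n : ℕ) (H : ℝ) {t s : ℝ} (hs : s < t) :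
    kernelG n H t s = iteratedDeriv n (fun h => (t - s) ^ (h - 1 / 2)) H := by
  induction n generalizing H with
  | zero => simp [kernelG]
  | succ n ih =>
    rw [iteratedDeriv_succ, ← (hasDerivAt_kernelG_hurst n H hs).deriv]
    congr 1
    exact funext fun h => ih h

/-- `∂_s g_H^{(n)}(t,s) = -n log^{n-1}(t-s) (t-s)^{H-3/2} - (H-1/2) log^n(t-s) (t-s)^{H-3/2}`. -/
theorem hasDerivAt_kernelG (n : ℕ) (H : ℝ) {t s : ℝ} (hs : s < t) :
    HasDerivAt (fun u => kernelG n H t u)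
      (-n * Real.log (t - s) ^ (n - 1) * (t - s) ^ (H - 3 / 2)
        - (H - 1 / 2) * Real.log (t - s) ^ n * (t - s) ^ (H - 3 / 2)) s := by
  have h0 : 0 < t - s := sub_pos.2 hs
  have h1 : HasDerivAt (fun u => t - u) (-1) s := by
    simpa using (hasDerivAt_id s).const_sub t
  have h2 := ((h1.log h0.ne').pow n).mul (h1.rpow_const (p := H - 1 / 2) (Or.inl h0.ne'))
  refine h2.congr_deriv ?_
  have e1 : (t - s) ^ (H - 1 / 2) = (t - s) ^ (H - 3 / 2) * (t - s) := by
    rw [← Real.rpow_add_one h0.ne']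
    congr 1
    ring
  have e2 : H - 1 / 2 - 1 = H - 3 / 2 := by ring
  simp only [Pi.pow_apply, e1, e2]
  field_simp
  ring

/-- `f_H^{(n)}(t,s) = g_H^{(n)}(t,s) - g_H^{(n)}(0,s)`. -/
theorem kernelF_eq (n : ℕ) (H t s : ℝ) : kernelF n H t s = kernelG n H t s - kernelG n H 0 s := by
  simp [kernelF, kernelG]

/-! The argument is pathwise, on one almost sure event independent of `n`, `H` and `t`: both halves
of the path are locally `α`-Hölder and grow at most like `s ^ (1 - α)` for every `α < 1/2`.

Up to logarithms, `∂_s g` has size `(t - s) ^ (H - 3/2)`. Near `s = t` the factor `B t - B s` brings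
the exponent to `H - 3/2 + α`, which is integrable when `α > 1/2 - H`; near `s = 0` from the left,
`B 0 = 0` plays the same role. At `-∞` the two terms of `∂_s f` cancel to order `|s| ^ (H - 5/2)`,
and against the growth `|s| ^ (1 - α)` this is integrable when `α > H - 1/2`. Some `α < 1/2` meets
both conditions because `0 < H < 1`.

The logarithms cost an arbitrarily small change of exponent, so the majorants can be taken uniform
for `H` in a compact interval. Dominated convergence then gives the `H`-derivative, and induction
gives smoothness.

Hölder continuity is Kolmogorov's dyadic argument (`ae_dyadic_increments_le`,
`abs_sub_le_of_dyadic_increments`); growth at infinity is Hölder continuity at `0` of the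
time-inverted path. The majorants are `exists_majorant_bounded` and `exists_majorant_unbounded`. -/

/-! ### Hölder bounds from dyadic increments -/

/-- If the dyadic increments of level `n` are at most `C * 2 ^ (-n α)`, then `f` is `α`-Hölder
between points at which `f` is the limit of its values at the lower dyadic approximations. -/
theorem abs_sub_le_of_dyadic_increments {f : ℝ → ℝ} {α C : ℝ} (hα : 0 < α) (hC : 0 ≤ C) {T : ℕ}
    (hf : ∀ n k : ℕ, k < T * 2 ^ n →
      |f ((k + 1 : ℕ) / 2 ^ n) - f (k / 2 ^ n)| ≤ C * ((2 : ℝ) ^ (-α)) ^ n)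
    {s t : ℝ} (hs : 0 ≤ s) (hst : s < t) (htT : t ≤ T) (hst1 : t - s ≤ 1)
    (hfs : Tendsto (fun n : ℕ => f (⌊s * 2 ^ n⌋₊ / 2 ^ n)) atTop (𝓝 (f s)))
    (hft : Tendsto (fun n : ℕ => f (⌊t * 2 ^ n⌋₊ / 2 ^ n)) atTop (𝓝 (f t))) :
    |f t - f s| ≤ C * (2 / (1 - (2 : ℝ) ^ (-α)) + 1) * 2 ^ α * (t - s) ^ α := by
  set r : ℝ := (2 : ℝ) ^ (-α) with hr
  have hr0 : 0 < r := Real.rpow_pos_of_pos two_pos _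
  have hr1 : r < 1 := Real.rpow_lt_one_of_one_lt_of_neg one_lt_two (by linarith)
  have step : ∀ u : ℝ, 0 ≤ u → u ≤ T → ∀ n : ℕ,
      dist (f (⌊u * 2 ^ n⌋₊ / 2 ^ n)) (f (⌊u * 2 ^ (n + 1)⌋₊ / 2 ^ (n + 1))) ≤ C * r ^ n := by
    intro u hu huT n
    have hp : (0 : ℝ) < 2 ^ n := by positivity
    -- Consecutive lower approximations coincide or are neighbours on the finer grid.
    have h1 : ⌊u * 2 ^ n⌋₊ = ⌊u * 2 ^ (n + 1)⌋₊ / 2 := by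
      rw [← Nat.floor_div_ofNat]
      congr 1
      rw [pow_succ]
      field_simp
    obtain h2 | h2 : ⌊u * 2 ^ (n + 1)⌋₊ = 2 * ⌊u * 2 ^ n⌋₊ ∨
        ⌊u * 2 ^ (n + 1)⌋₊ = 2 * ⌊u * 2 ^ n⌋₊ + 1 := by omega
    · have : (⌊u * 2 ^ (n + 1)⌋₊ : ℝ) / 2 ^ (n + 1) = ⌊u * 2 ^ n⌋₊ / 2 ^ n := by
        rw [h2, pow_succ]
        push_cast
        field_simp
      rw [this, dist_self]
      positivity
    · have h3 : (⌊u * 2 ^ n⌋₊ : ℝ) / 2 ^ n = (2 * ⌊u * 2 ^ n⌋₊ : ℕ) / 2 ^ (n + 1) := by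
        rw [pow_succ]
        push_cast
        field_simp
      have h4 : ⌊u * 2 ^ (n + 1)⌋₊ ≤ T * 2 ^ (n + 1) := by
        apply Nat.floor_le_of_le
        push_cast
        gcongr
      rw [dist_comm, Real.dist_eq, h2, h3]
      refine (hf (n + 1) _ (by omega)).trans ?_
      rw [pow_succ]
      have : C * r ^ n * r ≤ C * r ^ n * 1 := by gcongr
      linarith
  have lim : ∀ u : ℝ, 0 ≤ u → u ≤ T →
      Tendsto (fun n : ℕ => f (⌊u * 2 ^ n⌋₊ / 2 ^ n)) atTop (𝓝 (f u)) → ∀ m : ℕ,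
      |f (⌊u * 2 ^ m⌋₊ / 2 ^ m) - f u| ≤ C * r ^ m / (1 - r) := by
    intro u hu huT hlim m
    simpa [Real.dist_eq] using dist_le_of_le_geometric_of_tendsto r C hr1 (step u hu huT) hlim m
  -- The scale with `2 ^ (-(m + 1)) < t - s ≤ 2 ^ (-m)`: at level `m` the approximations of `s` and
  -- `t` are at most one grid step apart.
  obtain ⟨m, hm1, hm2⟩ := exists_nat_pow_near_of_lt_one (sub_pos.2 hst) hst1
    (by norm_num : (0 : ℝ) < 2⁻¹) (by norm_num)
  have hpm : (0 : ℝ) < 2 ^ m := by positivity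
  have hmid : |f (⌊t * 2 ^ m⌋₊ / 2 ^ m) - f (⌊s * 2 ^ m⌋₊ / 2 ^ m)| ≤ C * r ^ m := by
    have h1 : t * 2 ^ m ≤ s * 2 ^ m + 1 := by
      rw [inv_pow] at hm2
      have : (t - s) * 2 ^ m ≤ (2 ^ m)⁻¹ * 2 ^ m := by gcongr
      rw [inv_mul_cancel₀ hpm.ne'] at this
      linarith
    have h2 : ⌊t * 2 ^ m⌋₊ ≤ ⌊s * 2 ^ m⌋₊ + 1 := by
      rw [← Nat.floor_add_one (by positivity)]
      exact Nat.floor_le_floor h1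
    have h3 : ⌊s * 2 ^ m⌋₊ ≤ ⌊t * 2 ^ m⌋₊ := Nat.floor_le_floor (by gcongr)
    obtain h4 | h4 : ⌊t * 2 ^ m⌋₊ = ⌊s * 2 ^ m⌋₊ ∨ ⌊t * 2 ^ m⌋₊ = ⌊s * 2 ^ m⌋₊ + 1 := by omega
    · rw [h4, sub_self, abs_zero]
      positivity
    · have h5 : ⌊t * 2 ^ m⌋₊ ≤ T * 2 ^ m := by
        apply Nat.floor_le_of_le
        push_cast
        gcongr
      rw [h4]
      exact hf m _ (by omega)
  have hrm : r ^ m ≤ 2 ^ α * (t - s) ^ α := by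
    have h1 : r ^ m = 2 ^ α * ((2⁻¹ : ℝ) ^ (m + 1)) ^ α := by
      rw [← Real.rpow_natCast (2⁻¹), ← Real.rpow_mul (by norm_num), Real.inv_rpow two_pos.le,
        ← Real.rpow_neg two_pos.le, ← Real.rpow_add two_pos, hr, ← Real.rpow_natCast,
        ← Real.rpow_mul two_pos.le]
      congr 1
      push_cast
      ring
    rw [h1]
    gcongr
  have hs' := lim s hs (hst.le.trans htT) hfs m
  have ht' := lim t (hs.trans hst.le) htT hft m
  have h1r : 0 < 1 - r := by linarith
  calc |f t - f s| ≤ C * r ^ m / (1 - r) + C * r ^ m + C * r ^ m / (1 - r) := by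
        rw [abs_le] at *
        constructor <;> linarith
    _ = C * (2 / (1 - r) + 1) * r ^ m := by field_simp; ring
    _ ≤ C * (2 / (1 - r) + 1) * (2 ^ α * (t - s) ^ α) := by gcongr
    _ = _ := by ring

theorem tendsto_dyadic_floor {f : ℝ → ℝ} {s : ℝ} (hs : 0 ≤ s)
    (hf : ContinuousWithinAt f (Ici 0) s) :
    Tendsto (fun n : ℕ => f (⌊s * 2 ^ n⌋₊ / 2 ^ n)) atTop (𝓝 (f s)) := by
  refine Tendsto.comp hf (tendsto_nhdsWithin_iff.2 ⟨?_, .of_forall fun n => ?_⟩)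
  · exact (tendsto_nat_floor_mul_div_atTop hs).comp (tendsto_pow_atTop_atTop_of_one_lt one_lt_two)
  · simp only [mem_Ici]
    positivity

/-! ### Gaussian moments and regularity of Brownian paths -/

theorem lintegral_enorm_pow_gaussianReal (v : ℝ≥0) (p : ℕ) :
    ∫⁻ x, ‖x‖ₑ ^ p ∂gaussianReal 0 v =
      ‖√(v : ℝ)‖ₑ ^ p * ∫⁻ x, ‖x‖ₑ ^ p ∂gaussianReal 0 1 := by
  have h : gaussianReal 0 v = (gaussianReal 0 1).map (√(v : ℝ) * ·) := by
    rw [gaussianReal_map_const_mul]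
    congr 1
    · simp
    · ext
      simp
  rw [h, lintegral_map (by fun_prop) (by fun_prop), ← lintegral_const_mul _ (by fun_prop)]
  simp_rw [enorm_mul, mul_pow]

theorem lintegral_enorm_pow_gaussianReal_lt_top (p : ℕ) :
    ∫⁻ x, ‖x‖ₑ ^ p ∂gaussianReal 0 1 < ⊤ := by
  obtain rfl | hp := eq_or_ne p 0
  · simp
  have h := (memLp_id_gaussianReal (μ := 0) (v := 1) (p : ℝ≥0)).2
  rw [eLpNorm_lt_top_iff_lintegral_rpow_enorm_lt_top (by simpa using hp) (by simp)] at h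
  simpa using h

section Brownian

variable {Ω : Type*} [MeasurableSpace Ω] {P : Measure Ω}

/-- Summed over all levels and increments, the `p`-th powers of the rescaled increments have finite
expectation, so the sum is almost surely finite and bounds every term. -/
theorem ProbabilityTheory.IsPreBrownianReal.ae_dyadic_increments_le {X : ℝ≥0 → Ω → ℝ}
    (hX : IsPreBrownianReal X P) {α : ℝ} (hα : α < 1 / 2) (T : ℕ) :
    ∀ᵐ ω ∂P, ∃ C : ℝ, 0 ≤ C ∧ ∀ n k : ℕ, k < T * 2 ^ n →
      |X ((k + 1 : ℕ) / 2 ^ n) ω - X (k / 2 ^ n) ω| ≤ C * ((2 : ℝ) ^ (-α)) ^ n := by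
  set a : ℝ := 2 ^ α with ha
  have ha0 : 0 < a := Real.rpow_pos_of_pos two_pos _
  set q : ℝ := a * √(2⁻¹) with hq
  have hq0 : 0 < q := by positivity
  have hq1 : q < 1 := by
    rw [hq, ha, Real.sqrt_eq_rpow, Real.inv_rpow two_pos.le, ← Real.rpow_neg two_pos.le,
      ← Real.rpow_add two_pos]
    exact Real.rpow_lt_one_of_one_lt_of_neg one_lt_two (by linarith)
  -- A rescaled increment of level `n` has `p`-th moment proportional to `q ^ (p n)`, and there are
  -- `T * 2 ^ n` of them; `q ^ p < 1/2` makes the series geometric.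
  obtain ⟨p, hp⟩ := exists_pow_lt_of_lt_one (show (0 : ℝ) < 2⁻¹ by norm_num) hq1
  have hp0 : p ≠ 0 := by
    rintro rfl
    norm_num at hp
  let D : ℕ → ℕ → Ω → ℝ := fun n k ω => X ((k + 1 : ℕ) / 2 ^ n) ω - X (k / 2 ^ n) ω
  have hD : ∀ n k, AEMeasurable (D n k) P := fun n k =>
    (hX.aemeasurable _).sub (hX.aemeasurable _)
  let M := ∫⁻ x, ‖x‖ₑ ^ p ∂gaussianReal 0 1
  have hDint : ∀ n k, ∫⁻ ω, ‖a ^ n * D n k ω‖ₑ ^ p ∂P = ‖q ^ p‖ₑ ^ n * M := by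
    intro n k
    have h1 := (hX.hasLaw_sub ((k + 1 : ℕ) / 2 ^ n) (k / 2 ^ n)).lintegral_comp
      (f := fun x => ‖x‖ₑ ^ p) (by fun_prop)
    have h2 : nndist (((k + 1 : ℕ) / 2 ^ n : ℝ≥0) : ℝ) ((k / 2 ^ n : ℝ≥0) : ℝ) = (2⁻¹) ^ n := by
      ext
      rw [coe_nndist, Real.dist_eq]
      push_cast
      rw [← sub_div, add_sub_cancel_left, abs_of_pos (by positivity)]
      simp
    erw [h2] at h1
    rw [lintegral_enorm_pow_gaussianReal] at h1
    simp_rw [enorm_mul, mul_pow]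
    rw [lintegral_const_mul'' _ ((hD n k).enorm.pow_const p)]
    refine (congrArg _ h1).trans ?_
    rw [← mul_assoc, ← mul_pow, ← enorm_mul, ← enorm_pow, ← enorm_pow]
    congr 2
    rw [← pow_mul, mul_comm p n, pow_mul]
    congr 1
    rw [hq, mul_pow]
    congr 1
    push_cast
    rw [Real.sqrt_eq_rpow, Real.sqrt_eq_rpow, ← Real.rpow_natCast, ← Real.rpow_natCast,
      ← Real.rpow_mul (by positivity), ← Real.rpow_mul (by positivity), mul_comm]
  have hsum : ∫⁻ ω, ∑' n, ∑ k ∈ Finset.range (T * 2 ^ n), ‖a ^ n * D n k ω‖ₑ ^ p ∂P ≠ ⊤ := by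
    rw [lintegral_tsum fun n => Finset.aemeasurable_fun_sum _ fun k _ =>
      ((hD n k).const_mul _).enorm.pow_const p]
    have h1 : ∀ n, ∫⁻ ω, ∑ k ∈ Finset.range (T * 2 ^ n), ‖a ^ n * D n k ω‖ₑ ^ p ∂P
        = T * M * (‖2 * q ^ p‖ₑ) ^ n := by
      intro n
      rw [lintegral_finsetSum' _ fun k _ => ((hD n k).const_mul _).enorm.pow_const p]
      simp_rw [hDint]
      rw [Finset.sum_const, Finset.card_range, nsmul_eq_mul, enorm_mul, mul_pow]
      have : ‖(2 : ℝ)‖ₑ = 2 := by simp [Real.enorm_eq_ofReal]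
      rw [this]
      push_cast
      ring
    simp_rw [h1]
    rw [ENNReal.tsum_mul_left, ENNReal.tsum_geometric]
    refine ENNReal.mul_ne_top (ENNReal.mul_ne_top (by simp)
      (lintegral_enorm_pow_gaussianReal_lt_top p).ne) ?_
    rw [ENNReal.inv_ne_top, ← pos_iff_ne_zero, tsub_pos_iff_lt, Real.enorm_eq_ofReal (by positivity),
      ENNReal.ofReal_lt_one]
    linarith
  have hmeas : AEMeasurable
      (fun ω => ∑' n, ∑ k ∈ Finset.range (T * 2 ^ n), ‖a ^ n * D n k ω‖ₑ ^ p) P :=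
    AEMeasurable.tsum fun n => Finset.aemeasurable_fun_sum _ fun k _ =>
      ((hD n k).const_mul _).enorm.pow_const p
  filter_upwards [ae_lt_top' hmeas hsum] with ω hω
  set S := ∑' n, ∑ k ∈ Finset.range (T * 2 ^ n), ‖a ^ n * D n k ω‖ₑ ^ p with hS
  -- Adding `1` avoids a `p`-th root: a number above `1` is at most its `p`-th power.
  refine ⟨1 + S.toReal, by positivity, fun n k hk => ?_⟩
  have h1 : ‖a ^ n * D n k ω‖ₑ ^ p ≤ S :=
    (Finset.single_le_sum (f := fun k => ‖a ^ n * D n k ω‖ₑ ^ p) (fun _ _ => zero_le)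
      (Finset.mem_range.2 hk)).trans
      (ENNReal.le_tsum (f := fun n => ∑ k ∈ Finset.range (T * 2 ^ n), ‖a ^ n * D n k ω‖ₑ ^ p) n)
  have h2 : |a ^ n * D n k ω| ^ p ≤ S.toReal := by
    rw [← Real.norm_eq_abs, ← toReal_enorm, ← ENNReal.toReal_pow]
    exact ENNReal.toReal_mono hω.ne h1
  have h3 : |a ^ n * D n k ω| ≤ 1 + S.toReal := by
    by_contra! h
    have h4 : 1 ≤ 1 + S.toReal := by linarith [ENNReal.toReal_nonneg (a := S)]
    have h5 := le_self_pow₀ (h4.trans h.le) hp0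
    linarith
  rw [abs_mul, abs_of_pos (by positivity)] at h3
  rw [Real.rpow_neg two_pos.le, inv_pow, ← div_eq_mul_inv, le_div_iff₀ (by positivity), mul_comm]
  exact h3

/-- Half-line paths started at `0` that are locally Hölder of every order less than `1 / 2` and
grow more slowly than every power of order more than `1 / 2`. -/
structure IsRegularPath (b : ℝ → ℝ) : Prop where
  zero : b 0 = 0
  continuousOn : ContinuousOn b (Ici 0)
  holder : ∀ α : ℝ, 0 < α → α < 1 / 2 → ∀ T : ℕ, ∃ C : ℝ, ∀ s t : ℝ, 0 ≤ s → s < t → t ≤ T →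
    t - s ≤ 1 → |b t - b s| ≤ C * (t - s) ^ α
  growth : ∀ α : ℝ, 0 < α → α < 1 / 2 → ∃ C : ℝ, ∀ s : ℝ, 1 ≤ s → |b s| ≤ C * s ^ (1 - α)

/-- The exponents `1/2 - 1/(j + 3)` are positive and increase to `1/2`; a countable family lets one
null set serve every `α`. -/
theorem exists_nat_lt_half_sub_inv {α : ℝ} (hα : α < 1 / 2) :
    ∃ j : ℕ, α ≤ 1 / 2 - 1 / ((j + 2 : ℕ) + 1 : ℝ) := by
  obtain ⟨j, hj⟩ := exists_nat_one_div_lt (sub_pos.2 hα)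
  refine ⟨j, ?_⟩
  have : 1 / ((j + 2 : ℕ) + 1 : ℝ) ≤ 1 / (j + 1 : ℝ) := by
    apply one_div_le_one_div_of_le (by positivity)
    push_cast
    linarith
  linarith

theorem half_sub_inv_pos (j : ℕ) : (0 : ℝ) < 1 / 2 - 1 / ((j + 2 : ℕ) + 1 : ℝ) := by
  rw [sub_pos]
  apply one_div_lt_one_div_of_lt two_pos
  push_cast
  linarith [(Nat.cast_nonneg j : (0 : ℝ) ≤ j)]

theorem half_sub_inv_lt (j : ℕ) : 1 / 2 - 1 / ((j + 2 : ℕ) + 1 : ℝ) < (1 / 2 : ℝ) :=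
  sub_lt_self _ (by positivity)

theorem Real.toNNReal_natCast_div_two_pow (k n : ℕ) :
    ((k : ℝ) / 2 ^ n).toNNReal = (k : ℝ≥0) / 2 ^ n := by
  rw [Real.toNNReal_div (by positivity), Real.toNNReal_natCast, Real.toNNReal_pow two_pos.le]
  simp

theorem ProbabilityTheory.IsBrownianReal.ae_isRegularPath {X : ℝ≥0 → Ω → ℝ}
    (hX : IsBrownianReal X P) : ∀ᵐ ω ∂P, IsRegularPath fun s => X s.toNNReal ω := by
  have hα := half_sub_inv_lt
  have h1 := ae_all_iff.2 fun j : ℕ => ae_all_iff.2 fun T : ℕ =>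
    hX.toIsPreBrownianReal.ae_dyadic_increments_le (hα j) T
  have h2 := ae_all_iff.2 fun j : ℕ =>
    hX.toIsPreBrownianReal.inv.ae_dyadic_increments_le (hα j) 1
  filter_upwards [h1, h2, hX.cont, hX.eval_zero_ae_eq_zero] with ω h1 h2 hc h0
  have hcont : Continuous fun s : ℝ => X s.toNNReal ω := hc.comp continuous_real_toNNReal
  refine ⟨by simpa using h0, hcont.continuousOn, ?_, ?_⟩
  · intro α hα0 hα T
    obtain ⟨j, hj⟩ := exists_nat_lt_half_sub_inv hα
    obtain ⟨C, hC, h⟩ := h1 j T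
    have hβ := half_sub_inv_pos j
    generalize 1 / 2 - 1 / ((j + 2 : ℕ) + 1 : ℝ) = β at hβ hj h
    refine ⟨C * (2 / (1 - (2 : ℝ) ^ (-β)) + 1) * 2 ^ β, fun s t hs hst htT hst1 => ?_⟩
    · refine (abs_sub_le_of_dyadic_increments (f := fun s : ℝ => X s.toNNReal ω)
        hβ hC ?_ hs hst htT hst1
        (tendsto_dyadic_floor hs hcont.continuousWithinAt)
        (tendsto_dyadic_floor (hs.trans hst.le) hcont.continuousWithinAt)).trans ?_
      · simpa only [Real.toNNReal_natCast_div_two_pow] using h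
      · refine mul_le_mul_of_nonneg_left
          (Real.rpow_le_rpow_of_exponent_ge (sub_pos.2 hst) hst1 hj) ?_
        have : (2 : ℝ) ^ (-β) < 1 :=
          Real.rpow_lt_one_of_one_lt_of_neg one_lt_two (neg_lt_zero.2 hβ)
        have := sub_pos.2 this
        positivity
  · intro α hα0 hα
    obtain ⟨j, hj⟩ := exists_nat_lt_half_sub_inv hα
    obtain ⟨C, hC, h⟩ := h2 j
    have hβ := half_sub_inv_pos j
    generalize 1 / 2 - 1 / ((j + 2 : ℕ) + 1 : ℝ) = β at hβ hj h
    have hr : (2 : ℝ) ^ (-β) < 1 :=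
      Real.rpow_lt_one_of_one_lt_of_neg one_lt_two (neg_lt_zero.2 hβ)
    have hr' := sub_pos.2 hr
    -- Time inversion: a bound `|W u| ≤ C * u ^ β` on `(0, 1]` becomes a growth bound for `X` at `s
    -- = 1/u`.
    let W : ℝ → ℝ := fun u => u.toNNReal * X (1 / u.toNNReal) ω
    have hW0 : W 0 = 0 := by simp [W]
    refine ⟨C * (2 / (1 - (2 : ℝ) ^ (-β)) + 1) * 2 ^ β, fun s hs => ?_⟩
    have hs0 : 0 < s := by linarith
    have hWs : W s⁻¹ = s⁻¹ * X s.toNNReal ω := by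
      simp only [W]
      rw [Real.coe_toNNReal _ (by positivity), Real.toNNReal_inv, one_div, inv_inv]
    -- All dyadic approximations of `0` are `0`, so continuity of `W` is needed only at `s⁻¹`.
    have key := abs_sub_le_of_dyadic_increments (f := W) (s := 0) (t := s⁻¹) (T := 1)
        hβ hC ?_ le_rfl (by positivity) (by simpa using inv_le_one_of_one_le₀ hs)
        (by simpa using inv_le_one_of_one_le₀ hs) (by simp)
        (tendsto_dyadic_floor (by positivity) (ContinuousAt.continuousWithinAt ?_))
    · rw [hW0, hWs, sub_zero, sub_zero, abs_mul, abs_of_pos (inv_pos.2 hs0),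
        inv_mul_le_iff₀ hs0, Real.inv_rpow hs0.le, ← Real.rpow_neg hs0.le] at key
      refine key.trans ?_
      rw [mul_left_comm, sub_eq_add_neg 1 α, Real.rpow_add hs0, Real.rpow_one]
      gcongr
    · simpa only [W, Real.toNNReal_natCast_div_two_pow] using h
    · have hne : (s⁻¹).toNNReal ≠ 0 := by
        rw [Ne, Real.toNNReal_eq_zero, not_le]
        positivity
      refine (NNReal.continuous_coe.comp continuous_real_toNNReal).continuousAt.mul ?_
      refine hc.continuousAt.comp ?_
      exact continuous_const.continuousAt.div continuous_real_toNNReal.continuousAt hne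

theorem IsRegularPath.congr {b c : ℝ → ℝ} (hb : IsRegularPath b) (h : EqOn c b (Ici 0)) :
    IsRegularPath c where
  zero := by rw [h self_mem_Ici, hb.zero]
  continuousOn := hb.continuousOn.congr h
  holder α h0 h1 T := by
    obtain ⟨C, hC⟩ := hb.holder α h0 h1 T
    refine ⟨C, fun s t hs hst => ?_⟩
    rw [h (hs.trans hst.le), h hs]
    exact hC s t hs hst
  growth α h0 h1 := by
    obtain ⟨C, hC⟩ := hb.growth α h0 h1
    refine ⟨C, fun s hs => ?_⟩
    rw [h (zero_le_one.trans hs)]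
    exact hC s hs

theorem IsTwoSidedWiener.ae_isRegularPath {B : ℝ → Ω → ℝ} (hB : IsTwoSidedWiener B P) :
    ∀ᵐ ω ∂P, IsRegularPath (fun s => B s ω) ∧ IsRegularPath fun s => B (-s) ω := by
  filter_upwards [hB.forward.ae_isRegularPath, hB.backward.ae_isRegularPath] with ω h1 h2
  refine ⟨h1.congr fun s hs => ?_, h2.congr fun s hs => ?_⟩ <;>
  simp only [Real.coe_toNNReal s hs]

end Brownian

/-! ### Estimates for the kernel derivative -/

/-- The derivative in `u` of `log u ^ n * u ^ (H - 1 / 2)`. -/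
noncomputable def logPowKernel (n : ℕ) (H u : ℝ) : ℝ :=
  (n * Real.log u ^ (n - 1) + (H - 1 / 2) * Real.log u ^ n) * u ^ (H - 3 / 2)

theorem deriv_kernelG (n : ℕ) (H : ℝ) {t s : ℝ} (hs : s < t) :
    deriv (fun u => kernelG n H t u) s = -logPowKernel n H (t - s) := by
  rw [(hasDerivAt_kernelG n H hs).deriv, logPowKernel]
  ring

theorem deriv_kernelF (n : ℕ) (H : ℝ) {t s : ℝ} (ht : 0 ≤ t) (hs : s < 0) :
    deriv (fun u => kernelF n H t u) s = logPowKernel n H (-s) - logPowKernel n H (t - s) := by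
  simp_rw [kernelF_eq]
  have h1 := hasDerivAt_kernelG n H (hs.trans_le ht)
  have h2 := hasDerivAt_kernelG n H hs
  rw [deriv_fun_sub h1.differentiableAt h2.differentiableAt, deriv_kernelG n H (hs.trans_le ht),
    deriv_kernelG n H hs, zero_sub]
  ring

theorem hasDerivAt_logPowKernel_hurst (n : ℕ) (H : ℝ) {u : ℝ} (hu : 0 < u) :
    HasDerivAt (fun h => logPowKernel n h u) (logPowKernel (n + 1) H u) H := by
  have h1 := ((hasDerivAt_id H).sub_const (3 / 2 : ℝ)).const_rpow hu
  have h2 := (((hasDerivAt_id H).sub_const (1 / 2 : ℝ)).mul_const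
    (Real.log u ^ n)).const_add (n * Real.log u ^ (n - 1))
  refine (h2.mul h1).congr_deriv ?_
  -- The split settles the truncated `n - 1`; at `n = 0` its coefficient vanishes.
  obtain _ | n := n <;>
  · simp only [logPowKernel, id, Nat.add_sub_cancel]
    push_cast
    ring

theorem hasDerivAt_logPowKernel (n : ℕ) (H : ℝ) {u : ℝ} (hu : 0 < u) :
    HasDerivAt (logPowKernel n H)
      ((n * ((n - 1 : ℕ) * Real.log u ^ (n - 1 - 1)) + (H - 1 / 2) * (n * Real.log u ^ (n - 1))
        + (n * Real.log u ^ (n - 1) + (H - 1 / 2) * Real.log u ^ n) * (H - 3 / 2))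
        * u ^ (H - 5 / 2)) u := by
  have hl := Real.hasDerivAt_log hu.ne'
  have h1 := ((hl.pow (n - 1)).const_mul (n : ℝ)).add ((hl.pow n).const_mul (H - 1 / 2))
  have h2 := Real.hasDerivAt_rpow_const (p := H - 3 / 2) (Or.inl hu.ne')
  refine (h1.mul h2).congr_deriv ?_
  have e1 : u ^ (H - 3 / 2) = u ^ (H - 5 / 2) * u := by
    rw [← Real.rpow_add_one hu.ne']
    congr 1
    ring
  have e2 : H - 3 / 2 - 1 = H - 5 / 2 := by ring
  simp only [Pi.pow_apply, Pi.add_apply, e1, e2]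
  field_simp

/-- `|log u| ^ n` is at most a constant times `exp (δ * |log u|)`, which is `u ^ (-δ)` for `u ≤ 1`
and `u ^ δ` for `u ≥ 1`. -/
theorem exists_abs_log_pow_mul_rpow_le (n : ℕ) {a' a c c' : ℝ} (ha : a' < a) (hc : c < c') :
    ∃ C : ℝ, 0 ≤ C ∧ ∀ h ∈ Icc a c, ∀ u : ℝ, 0 < u →
      |Real.log u| ^ n * u ^ h ≤ C * (u ^ a' + u ^ c') := by
  set δ := min (a - a') (c' - c) with hδ
  have hδ0 : 0 < δ := lt_min (sub_pos.2 ha) (sub_pos.2 hc)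
  refine ⟨n.factorial / δ ^ n, by positivity, fun h hh u hu => ?_⟩
  have h1 := Real.pow_div_factorial_le_exp (δ * |Real.log u|) (by positivity) n
  rw [div_le_iff₀ (by positivity), mul_pow] at h1
  have h2 : |Real.log u| ^ n ≤ n.factorial / δ ^ n * Real.exp (δ * |Real.log u|) := by
    rw [div_mul_eq_mul_div, le_div_iff₀ (by positivity)]
    linarith
  refine (mul_le_mul_of_nonneg_right h2 (by positivity)).trans ?_
  rw [mul_assoc]
  gcongr
  have hδ1 : δ ≤ a - a' := min_le_left _ _
  have hδ2 : δ ≤ c' - c := min_le_right _ _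
  obtain hu1 | hu1 := le_total u 1
  · have h3 : Real.exp (δ * |Real.log u|) = u ^ (-δ) := by
      rw [abs_of_nonpos (Real.log_nonpos hu.le hu1), Real.rpow_def_of_pos hu]
      congr 1
      ring
    rw [h3, ← Real.rpow_add hu]
    have : u ^ (-δ + h) ≤ u ^ a' :=
      Real.rpow_le_rpow_of_exponent_ge hu hu1 (by linarith [hh.1])
    linarith [Real.rpow_pos_of_pos hu c']
  · have h3 : Real.exp (δ * |Real.log u|) = u ^ δ := by
      rw [abs_of_nonneg (Real.log_nonneg hu1), Real.rpow_def_of_pos hu]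
      congr 1
      ring
    rw [h3, ← Real.rpow_add hu]
    have : u ^ (δ + h) ≤ u ^ c' :=
      Real.rpow_le_rpow_of_exponent_le hu1 (by linarith [hh.2])
    linarith [Real.rpow_pos_of_pos hu a']

theorem exists_abs_logPowKernel_le (n : ℕ) {a' a c c' : ℝ} (ha' : a' < a) (ha : 0 ≤ a)
    (hc : c ≤ 1) (hc' : c < c') :
    ∃ C : ℝ, 0 ≤ C ∧ ∀ H ∈ Icc a c, ∀ u : ℝ, 0 < u →
      |logPowKernel n H u| ≤ C * (u ^ (a' - 3 / 2) + u ^ (c' - 3 / 2)) := by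
  have e1 := sub_lt_sub_right ha' (3 / 2)
  have e2 := sub_lt_sub_right hc' (3 / 2)
  obtain ⟨C1, hC1, h1⟩ := exists_abs_log_pow_mul_rpow_le (n - 1) e1 e2
  obtain ⟨C2, hC2, h2⟩ := exists_abs_log_pow_mul_rpow_le n e1 e2
  refine ⟨n * C1 + C2, by positivity, fun H hH u hu => ?_⟩
  have hH' : H - 3 / 2 ∈ Icc (a - 3 / 2) (c - 3 / 2) :=
    ⟨sub_le_sub_right hH.1 _, sub_le_sub_right hH.2 _⟩
  have hH1 : |H - 1 / 2| ≤ 1 := abs_le.2 ⟨by linarith [hH.1], by linarith [hH.2]⟩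
  have k1 := h1 _ hH' u hu
  have k2 := h2 _ hH' u hu
  rw [logPowKernel, abs_mul, abs_of_pos (Real.rpow_pos_of_pos hu _)]
  calc _ ≤ (n * |Real.log u| ^ (n - 1) + 1 * |Real.log u| ^ n) * u ^ (H - 3 / 2) := by
        gcongr
        refine (abs_add_le _ _).trans ?_
        rw [abs_mul, abs_mul, abs_pow, abs_pow, Nat.abs_cast]
        gcongr
    _ = n * (|Real.log u| ^ (n - 1) * u ^ (H - 3 / 2)) + |Real.log u| ^ n * u ^ (H - 3 / 2) := by
        ring
    _ ≤ n * (C1 * (u ^ (a' - 3 / 2) + u ^ (c' - 3 / 2)))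
        + C2 * (u ^ (a' - 3 / 2) + u ^ (c' - 3 / 2)) := by gcongr
    _ = _ := by ring

/-- Mean value inequality on `[v, ∞)`: the exponents bounding the derivative are negative, so the
bound is largest at `v`. The power of `v` gained here yields convergence at infinity. -/
theorem exists_abs_logPowKernel_sub_le (n : ℕ) {a' a c c' : ℝ} (ha' : a' < a) (ha : 0 ≤ a)
    (hac : a ≤ c) (hc : c ≤ 1) (hc' : c < c') (hc1 : c' ≤ 1) :
    ∃ C : ℝ, 0 ≤ C ∧ ∀ H ∈ Icc a c, ∀ t v : ℝ, 0 ≤ t → 0 < v →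
      |logPowKernel n H v - logPowKernel n H (t + v)| ≤
        C * (v ^ (a' - 5 / 2) + v ^ (c' - 5 / 2)) * t := by
  have e1 := sub_lt_sub_right ha' (5 / 2)
  have e2 := sub_lt_sub_right hc' (5 / 2)
  obtain ⟨C0, hC0, h0⟩ := exists_abs_log_pow_mul_rpow_le (n - 1 - 1) e1 e2
  obtain ⟨C1, hC1, h1⟩ := exists_abs_log_pow_mul_rpow_le (n - 1) e1 e2
  obtain ⟨C2, hC2, h2⟩ := exists_abs_log_pow_mul_rpow_le n e1 e2
  refine ⟨n * ((n - 1 : ℕ) * C0) + n * C1 + (n * C1 + C2) * 2, by positivity,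
    fun H hH t v ht hv => ?_⟩
  have hH' : H - 5 / 2 ∈ Icc (a - 5 / 2) (c - 5 / 2) :=
    ⟨sub_le_sub_right hH.1 _, sub_le_sub_right hH.2 _⟩
  have hH1 : |H - 1 / 2| ≤ 1 := abs_le.2 ⟨by linarith [hH.1], by linarith [hH.2]⟩
  have hH2 : |H - 3 / 2| ≤ 2 := abs_le.2 ⟨by linarith [hH.1], by linarith [hH.2]⟩
  have key := (convex_Ici v).norm_image_sub_le_of_norm_hasDerivWithin_le (f := logPowKernel n H)
    (C := (n * ((n - 1 : ℕ) * C0) + n * C1 + (n * C1 + C2) * 2) *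
      (v ^ (a' - 5 / 2) + v ^ (c' - 5 / 2)))
    (fun u hu => (hasDerivAt_logPowKernel n H (hv.trans_le hu)).hasDerivWithinAt) ?_
    (show t + v ∈ Ici v by simpa using ht) self_mem_Ici
  · rw [Real.norm_eq_abs, Real.norm_eq_abs, sub_add_cancel_right, abs_neg, abs_of_nonneg ht] at key
    exact key
  · intro u hu
    have hu0 : 0 < u := hv.trans_le hu
    have k0 := h0 _ hH' u hu0
    have k1 := h1 _ hH' u hu0
    have k2 := h2 _ hH' u hu0
    have m1 : u ^ (a' - 5 / 2) ≤ v ^ (a' - 5 / 2) :=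
      Real.rpow_le_rpow_of_nonpos hv hu (by linarith)
    have m2 : u ^ (c' - 5 / 2) ≤ v ^ (c' - 5 / 2) :=
      Real.rpow_le_rpow_of_nonpos hv hu (by linarith)
    rw [Real.norm_eq_abs, abs_mul, abs_of_pos (Real.rpow_pos_of_pos hu0 _)]
    set L := Real.log u
    calc _ ≤ (n * ((n - 1 : ℕ) * |L| ^ (n - 1 - 1)) + 1 * (n * |L| ^ (n - 1))
          + (n * |L| ^ (n - 1) + 1 * |L| ^ n) * 2) * u ^ (H - 5 / 2) := by
          gcongr
          refine (abs_add_le _ _).trans (add_le_add ((abs_add_le _ _).trans ?_) ?_)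
          · simp only [abs_mul, abs_pow, Nat.abs_cast]
            gcongr
          · rw [abs_mul]
            gcongr
            refine (abs_add_le _ _).trans ?_
            simp only [abs_mul, abs_pow, Nat.abs_cast]
            gcongr
      _ = n * ((n - 1 : ℕ) * (|L| ^ (n - 1 - 1) * u ^ (H - 5 / 2)))
          + n * (|L| ^ (n - 1) * u ^ (H - 5 / 2))
          + (n * (|L| ^ (n - 1) * u ^ (H - 5 / 2)) + |L| ^ n * u ^ (H - 5 / 2)) * 2 := by ring
      _ ≤ n * ((n - 1 : ℕ) * (C0 * (u ^ (a' - 5 / 2) + u ^ (c' - 5 / 2))))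
          + n * (C1 * (u ^ (a' - 5 / 2) + u ^ (c' - 5 / 2)))
          + (n * (C1 * (u ^ (a' - 5 / 2) + u ^ (c' - 5 / 2)))
          + C2 * (u ^ (a' - 5 / 2) + u ^ (c' - 5 / 2))) * 2 := by gcongr
      _ = (n * ((n - 1 : ℕ) * C0) + n * C1 + (n * C1 + C2) * 2) *
          (u ^ (a' - 5 / 2) + u ^ (c' - 5 / 2)) := by ring
      _ ≤ _ := by gcongr

/-! ### Differentiation under the integral sign -/

/-- Differentiation under the integral sign for a sequence of integrands each of which is the
parameter derivative of the preceding one. -/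
theorem hasDerivAt_integral_of_locally_dominated {μ : Measure ℝ} {F : ℕ → ℝ → ℝ → ℝ} {p q : ℝ}
    (hmeas : ∀ n H, AEStronglyMeasurable (F n H) μ)
    (hdom : ∀ n a c, p < a → a ≤ c → c < q → ∃ G : ℝ → ℝ, Integrable G μ ∧
      ∀ᵐ u ∂μ, ∀ H ∈ Icc a c, |F n H u| ≤ G u)
    (hderiv : ∀ n, ∀ᵐ u ∂μ, ∀ H, HasDerivAt (fun h => F n h u) (F (n + 1) H u) H)
    (n : ℕ) {H : ℝ} (hH : H ∈ Ioo p q) :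
    Integrable (F n H) μ ∧
      HasDerivAt (fun h => ∫ u, F n h u ∂μ) (∫ u, F (n + 1) H u ∂μ) H := by
  have hint : Integrable (F n H) μ := by
    obtain ⟨G, hG, hle⟩ := hdom n H H hH.1 le_rfl hH.2
    exact hG.mono' (hmeas n H) (hle.mono fun u hu => hu H (left_mem_Icc.2 le_rfl))
  refine ⟨hint, ?_⟩
  obtain ⟨a, ha1, ha2⟩ := exists_between hH.1
  obtain ⟨c, hc1, hc2⟩ := exists_between hH.2
  obtain ⟨G, hG, hle⟩ := hdom (n + 1) a c ha1 (ha2.trans hc1).le hc2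
  exact (hasDerivAt_integral_of_dominated_loc_of_deriv_le (Icc_mem_nhds ha2 hc1)
    (.of_forall (hmeas n)) hint (hmeas (n + 1) H) hle hG
    ((hderiv n).mono fun u hu h _ => hu h)).2

/-! ### Integrable majorants along a regular path -/

section Path

variable {b : ℝ → ℝ}

/-- Where `t - s ≥ 1` the Hölder bound is unavailable, but `(t - s) ^ α ≥ 1` and the path is bounded
on `[0, t]`. -/
theorem IsRegularPath.exists_abs_sub_le (hb : IsRegularPath b) {α : ℝ} (h0 : 0 < α)
    (h1 : α < 1 / 2) {t : ℝ} (ht : 0 ≤ t) :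
    ∃ C : ℝ, 0 ≤ C ∧ ∀ s ∈ Ico 0 t, |b t - b s| ≤ C * (t - s) ^ α := by
  obtain ⟨T, hT⟩ := exists_nat_ge t
  obtain ⟨C, hC⟩ := hb.holder α h0 h1 T
  obtain ⟨M, hM⟩ := isCompact_Icc.exists_bound_of_continuousOn
    (hb.continuousOn.mono (Icc_subset_Ici_self : Icc 0 t ⊆ Ici 0))
  have hM0 : 0 ≤ M := (norm_nonneg _).trans (hM t (right_mem_Icc.2 ht))
  refine ⟨|C| + 2 * M, by positivity, fun s hs => ?_⟩
  have hp : 0 < (t - s) ^ α := Real.rpow_pos_of_pos (sub_pos.2 hs.2) _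
  obtain h | h := le_total (t - s) 1
  · refine (hC s t hs.1 hs.2 hT h).trans ?_
    gcongr
    linarith [le_abs_self C]
  · have h2 : 1 ≤ (t - s) ^ α := Real.one_le_rpow h h0.le
    have h3 := hM t (right_mem_Icc.2 ht)
    have h4 := hM s (Ico_subset_Icc_self hs)
    rw [Real.norm_eq_abs] at h3 h4
    calc |b t - b s| ≤ 2 * M := by linarith [abs_sub (b t) (b s)]
      _ ≤ 2 * M * (t - s) ^ α := le_mul_of_one_le_right (by positivity) h2
      _ ≤ _ := by
        gcongr
        linarith [abs_nonneg C]

theorem IsRegularPath.exists_majorant_bounded (hb : IsRegularPath b) (n : ℕ) {a c t : ℝ}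
    (ha : 0 < a) (hc : c < 1) (ht : 0 ≤ t) :
    ∃ G : ℝ → ℝ, IntegrableOn G (Ioc 0 t) ∧ ∀ s ∈ Ioo 0 t, ∀ H ∈ Icc a c,
      |logPowKernel n H (t - s) * (b t - b s)| ≤ G s := by
  obtain ⟨a', ha'0, ha'⟩ := exists_between ha
  -- `α > 1/2 - a'` makes the exponent `a' - 3/2 + α` exceed `-1`.
  obtain ⟨α, hα, hα2⟩ := exists_between
    (max_lt one_half_pos (sub_lt_self _ ha'0) : max 0 (1 / 2 - a') < (1 / 2 : ℝ))
  obtain ⟨hα0, hα1⟩ := max_lt_iff.1 hα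
  obtain ⟨C, hC, hk⟩ := exists_abs_logPowKernel_le n ha' ha.le hc.le hc
  obtain ⟨M, hM, hbM⟩ := hb.exists_abs_sub_le hα0 hα2 ht
  refine ⟨fun s => C * M * ((t - s) ^ (a' - 3 / 2 + α) + (t - s) ^ ((1 : ℝ) - 3 / 2 + α)), ?_,
    fun s hs H hH => ?_⟩
  · have hi : ∀ r : ℝ, -1 < r → IntervalIntegrable (fun s => (t - s) ^ r) volume 0 t := by
      intro r hr
      have := (intervalIntegral.intervalIntegrable_rpow' (a := 0) (b := t) hr).comp_sub_left t
      simpa using this.symm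
    rw [← intervalIntegrable_iff_integrableOn_Ioc_of_le ht]
    exact ((hi _ (by linarith)).add (hi _ (by linarith))).const_mul _
  · have hts : 0 < t - s := sub_pos.2 hs.2
    beta_reduce
    rw [abs_mul, Real.rpow_add hts, Real.rpow_add hts]
    calc _ ≤ C * ((t - s) ^ (a' - 3 / 2) + (t - s) ^ ((1 : ℝ) - 3 / 2)) * (M * (t - s) ^ α) :=
          mul_le_mul (hk H hH _ hts) (hbM s (Ioo_subset_Ico_self hs)) (abs_nonneg _)
            (by positivity)
      _ = _ := by ring

theorem IsRegularPath.exists_majorant_unbounded (hb : IsRegularPath b) (n : ℕ) {a c t : ℝ}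
    (ha : 0 < a) (hac : a ≤ c) (hc : c < 1) (ht : 0 ≤ t) :
    ∃ G : ℝ → ℝ, IntegrableOn G (Ioi 0) ∧ ∀ v ∈ Ioi (0 : ℝ), ∀ H ∈ Icc a c,
      |(logPowKernel n H v - logPowKernel n H (t + v)) * b v| ≤ G v := by
  obtain ⟨a', ha'0, ha'⟩ := exists_between ha
  obtain ⟨c', hc', hc'1⟩ := exists_between hc
  -- `α > 1/2 - a'` gives integrability at `0`, where the two kernel terms are bounded separately;
  -- `α > c' - 1/2` gives `c' - 5/2 + (1 - α) < -1` at infinity, where their difference is used.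
  obtain ⟨α, hα, hα2⟩ := exists_between
    (max_lt (max_lt one_half_pos (sub_lt_self _ ha'0)) (by linarith) :
      max (max 0 (1 / 2 - a')) (c' - 1 / 2) < (1 / 2 : ℝ))
  obtain ⟨hα, hα3⟩ := max_lt_iff.1 hα
  obtain ⟨hα0, hα1⟩ := max_lt_iff.1 hα
  obtain ⟨C, hC, hk⟩ := exists_abs_logPowKernel_le n ha' ha.le hc.le hc'
  obtain ⟨D, hD, hkD⟩ := exists_abs_logPowKernel_sub_le n ha' ha.le hac hc.le hc' hc'1.le
  obtain ⟨M₁, hM₁, hbM₁⟩ : ∃ M : ℝ, 0 ≤ M ∧ ∀ v ∈ Ioc (0 : ℝ) 1, |b v| ≤ M * v ^ α := by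
    obtain ⟨M, hM⟩ := hb.holder α hα0 hα2 1
    have h : ∀ v ∈ Ioc (0 : ℝ) 1, |b v| ≤ M * v ^ α := fun v hv => by
      simpa [hb.zero] using hM 0 v le_rfl hv.1 (by simpa using hv.2) (by simpa using hv.2)
    exact ⟨M, by simpa using (abs_nonneg _).trans (h 1 ⟨one_pos, le_rfl⟩), h⟩
  obtain ⟨M₂, hM₂, hbM₂⟩ : ∃ M : ℝ, 0 ≤ M ∧ ∀ v : ℝ, 1 ≤ v → |b v| ≤ M * v ^ (1 - α) := by
    obtain ⟨M, hM⟩ := hb.growth α hα0 hα2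
    exact ⟨M, by simpa using (abs_nonneg _).trans (hM 1 le_rfl), hM⟩
  refine ⟨(Ioc 0 1).piecewise (fun v => 4 * C * M₁ * v ^ (a' - 3 / 2 + α))
    (fun v => 2 * D * t * M₂ * v ^ (c' - 5 / 2 + (1 - α))), ?_, fun v hv H hH => ?_⟩
  · rw [← Ioc_union_Ioi_eq_Ioi zero_le_one]
    refine IntegrableOn.union ?_ ?_
    · refine IntegrableOn.congr_fun ?_ (piecewise_eqOn _ _ _).symm measurableSet_Ioc
      rw [← intervalIntegrable_iff_integrableOn_Ioc_of_le zero_le_one]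
      exact (intervalIntegral.intervalIntegrable_rpow' (by linarith)).const_mul _
    · refine IntegrableOn.congr_fun ?_ (fun v (hv : 1 < v) =>
        (piecewise_eq_of_notMem _ _ _ fun h => h.2.not_gt hv).symm) measurableSet_Ioi
      exact (integrableOn_Ioi_rpow_of_lt (by linarith) one_pos).const_mul _
  · have hv0 : 0 < v := hv
    rw [abs_mul]
    obtain h1 | h1 := le_or_gt v 1
    · rw [piecewise_eq_of_mem _ _ _ (show v ∈ Ioc 0 1 from ⟨hv0, h1⟩), Real.rpow_add hv0]
      have hle : ∀ u : ℝ, v ≤ u → |logPowKernel n H u| ≤ 2 * C * v ^ (a' - 3 / 2) := by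
        intro u hu
        have e1 : u ^ (a' - 3 / 2) ≤ v ^ (a' - 3 / 2) :=
          Real.rpow_le_rpow_of_nonpos hv0 hu (by linarith)
        have e2 : u ^ (c' - 3 / 2) ≤ v ^ (a' - 3 / 2) :=
          (Real.rpow_le_rpow_of_nonpos hv0 hu (by linarith)).trans
            (Real.rpow_le_rpow_of_exponent_ge hv0 h1 (by linarith))
        calc _ ≤ C * (u ^ (a' - 3 / 2) + u ^ (c' - 3 / 2)) := hk H hH u (hv0.trans_le hu)
          _ ≤ C * (v ^ (a' - 3 / 2) + v ^ (a' - 3 / 2)) := by gcongr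
          _ = _ := by ring
      calc _ ≤ (2 * C * v ^ (a' - 3 / 2) + 2 * C * v ^ (a' - 3 / 2)) * (M₁ * v ^ α) := by
            gcongr
            · exact (abs_sub _ _).trans (add_le_add (hle v le_rfl) (hle _ (by linarith)))
            · exact hbM₁ v ⟨hv0, h1⟩
        _ = _ := by ring
    · rw [piecewise_eq_of_notMem _ _ _ (show v ∉ Ioc 0 1 from fun h => h.2.not_gt h1), Real.rpow_add hv0]
      have e1 : v ^ (a' - 5 / 2) ≤ v ^ (c' - 5 / 2) :=
        Real.rpow_le_rpow_of_exponent_le h1.le (by linarith)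
      calc _ ≤ D * (v ^ (c' - 5 / 2) + v ^ (c' - 5 / 2)) * t * (M₂ * v ^ (1 - α)) := by
            gcongr
            · exact (hkD H hH t v ht hv0).trans (by gcongr)
            · exact hbM₂ v h1.le
        _ = _ := by ring

theorem integrableOn_Iio_comp_neg_iff {f : ℝ → ℝ} :
    IntegrableOn (fun s => f (-s)) (Iio 0) ↔ IntegrableOn f (Ioi 0) := by
  have h := (Measure.measurePreserving_neg (volume : Measure ℝ)).integrableOn_comp_preimage
    (Homeomorph.neg ℝ).measurableEmbedding (f := f) (s := Ioi 0)
  simpa [Function.comp_def] using h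

theorem integrableOn_and_hasDerivAt_integral_kernelF (hb : IsRegularPath fun s => b (-s)) {t : ℝ}
    (ht : 0 ≤ t) (n : ℕ) {H : ℝ} (hH : H ∈ Ioo (0 : ℝ) 1) :
    IntegrableOn (fun s => deriv (fun u => kernelF n H t u) s * b s) (Iio 0) ∧
      HasDerivAt (fun h => ∫ s in Iio (0 : ℝ), deriv (fun u => kernelF n h t u) s * b s)
        (∫ s in Iio (0 : ℝ), deriv (fun u => kernelF (n + 1) H t u) s * b s) H := by
  refine hasDerivAt_integral_of_locally_dominated (μ := volume.restrict (Iio 0))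
    (F := fun n H s => deriv (fun u => kernelF n H t u) s * b s) (fun n H => ?_)
    (fun n a c ha hac hc => ?_) (fun n => ?_) n hH
  · refine (measurable_deriv _).aestronglyMeasurable.mul ?_
    have hc : ContinuousOn b (Iio 0) := by
      refine (hb.continuousOn.comp continuous_neg.continuousOn
        (t := Ici 0) (s := Iio 0) fun s (hs : s < 0) => ?_).congr fun s _ => by simp
      exact neg_nonneg.2 hs.le
    exact hc.aestronglyMeasurable measurableSet_Iio
  · obtain ⟨G, hG, hle⟩ := hb.exists_majorant_unbounded n ha hac hc ht
    refine ⟨fun s => G (-s), integrableOn_Iio_comp_neg_iff.2 hG, ?_⟩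
    filter_upwards [ae_restrict_mem measurableSet_Iio] with s hs H hH
    rw [deriv_kernelF n H ht hs]
    simpa [sub_eq_add_neg] using hle (-s) (mem_Ioi.2 (neg_pos.2 hs)) H hH
  · filter_upwards [ae_restrict_mem measurableSet_Iio] with s hs H
    have hs' : s < 0 := hs
    simp_rw [deriv_kernelF _ _ ht hs']
    exact ((hasDerivAt_logPowKernel_hurst n H (neg_pos.2 hs')).sub
      (hasDerivAt_logPowKernel_hurst n H (by linarith))).mul_const _

theorem intervalIntegrable_and_hasDerivAt_integral_kernelG (hb : IsRegularPath b) {t : ℝ}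
    (ht : 0 ≤ t) (n : ℕ) {H : ℝ} (hH : H ∈ Ioo (0 : ℝ) 1) :
    IntervalIntegrable (fun s => deriv (fun u => kernelG n H t u) s * (b t - b s)) volume 0 t ∧
      HasDerivAt (fun h => ∫ s in (0 : ℝ)..t, deriv (fun u => kernelG n h t u) s * (b t - b s))
        (∫ s in (0 : ℝ)..t, deriv (fun u => kernelG (n + 1) H t u) s * (b t - b s)) H := by
  simp_rw [intervalIntegrable_iff_integrableOn_Ioc_of_le ht, intervalIntegral.integral_of_le ht]
  -- The formula for the kernel derivative needs `s < t`, so the null endpoint is dropped.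
  have hmem : ∀ᵐ s ∂volume.restrict (Ioc 0 t), s ∈ Ioo 0 t := by
    rw [← Measure.restrict_congr_set Ioo_ae_eq_Ioc]
    exact ae_restrict_mem measurableSet_Ioo
  refine hasDerivAt_integral_of_locally_dominated (μ := volume.restrict (Ioc 0 t))
    (F := fun n H s => deriv (fun u => kernelG n H t u) s * (b t - b s)) (fun n H => ?_)
    (fun n a c ha hac hc => ?_) (fun n => ?_) n hH
  · refine (measurable_deriv _).aestronglyMeasurable.mul (aestronglyMeasurable_const.sub ?_)
    exact (hb.continuousOn.mono fun s hs => hs.1.le).aestronglyMeasurable measurableSet_Ioc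
  · obtain ⟨G, hG, hle⟩ := hb.exists_majorant_bounded n ha hc ht
    refine ⟨G, hG, ?_⟩
    filter_upwards [hmem] with s hs H hH
    rw [deriv_kernelG n H hs.2, neg_mul, abs_neg]
    exact hle s hs H hH
  · filter_upwards [hmem] with s hs H
    simp_rw [deriv_kernelG _ _ hs.2]
    exact (hasDerivAt_logPowKernel_hurst n H (sub_pos.2 hs.2)).neg.mul_const _

/-! ### The field and its derivatives in `H` -/

variable {Ω: Type*} {B : ℝ → Ω → ℝ} {ω : Ω}

theorem pwzWellDefined_of_isRegularPath (hf : IsRegularPath fun s => B s ω)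
    (hb : IsRegularPath fun s => B (-s) ω) (n : ℕ) {H t : ℝ} (hH : H ∈ Ioo (0 : ℝ) 1)
    (ht : 0 ≤ t) : PwzWellDefined B n H t ω :=
  ⟨(integrableOn_and_hasDerivAt_integral_kernelF (b := fun s => B s ω) hb ht n hH).1,
    (intervalIntegrable_and_hasDerivAt_integral_kernelG hf ht n hH).1⟩

theorem hasDerivAt_pwzField (hf : IsRegularPath fun s => B s ω)
    (hb : IsRegularPath fun s => B (-s) ω) (n : ℕ) {H t : ℝ} (hH : H ∈ Ioo (0 : ℝ) 1)
    (ht : 0 ≤ t) : HasDerivAt (fun h => pwzField B n h t ω) (pwzField B (n + 1) H t ω) H := by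
  refine ((integrableOn_and_hasDerivAt_integral_kernelF
    (b := fun s => B s ω) hb ht n hH).2.neg.add ?_).add
    (intervalIntegrable_and_hasDerivAt_integral_kernelG hf ht n hH).2
  -- At `t = 0` the kernel is evaluated off its domain, but `B 0 = 0` kills the term.
  obtain rfl | ht0 := ht.eq_or_lt
  · simpa [hf.zero] using hasDerivAt_const H (0 : ℝ)
  · exact (hasDerivAt_kernelG_hurst n H ht0).mul_const _

/-- A sequence of functions each of which is the derivative of the preceding one on an open set
consists of the iterated derivatives of its first term, which is smooth. -/
theorem contDiffOn_and_iteratedDeriv_of_hasDerivAt_succ {X : ℕ → ℝ → ℝ} {U : Set ℝ} (hU : IsOpen U)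
    (h : ∀ n, ∀ x ∈ U, HasDerivAt (X n) (X (n + 1) x) x) :
    ContDiffOn ℝ ((⊤ : ℕ∞) : WithTop ℕ∞) (X 0) U ∧ ∀ n, ∀ x ∈ U, iteratedDeriv n (X 0) x = X n x := by
  constructor
  · refine contDiffOn_infty.2 fun m => ?_
    -- Generalised over `n`, since the derivative of `X n` is `X (n + 1)`.
    suffices ∀ m n : ℕ, ContDiffOn ℝ m (X n) U from this m 0
    intro m
    induction m with
    | zero => exact fun n => contDiffOn_zero.2 fun x hx => (h n x hx).continuousAt.continuousWithinAt
    | succ m ih =>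
      intro n
      rw [Nat.cast_add_one]
      refine (contDiffOn_succ_iff_deriv_of_isOpen hU).2
        ⟨fun x hx => (h n x hx).differentiableAt.differentiableWithinAt, fun h => ?_, ?_⟩
      · exact absurd h (by simp)
      exact (ih (n + 1)).congr fun x hx => (h n x hx).deriv
  · intro n
    induction n with
    | zero => simp
    | succ n ih =>
      intro x hx
      rw [iteratedDeriv_succ, ← (h n x hx).deriv]
      exact EventuallyEq.deriv_eq (Filter.eventually_of_mem (hU.mem_nhds hx) ih)

end Path

theorem mainTheorem8 {Ω : Type*} [MeasurableSpace Ω] (P : Measure Ω) [IsProbabilityMeasure P]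
    (B : ℝ → Ω → ℝ) (hB : IsTwoSidedWiener B P) :
    (∀ n : ℕ, ∀ᵐ ω ∂P, ∀ H ∈ Ioo (0 : ℝ) 1, ∀ t : ℝ, 0 ≤ t → PwzWellDefined B n H t ω) ∧
    (∀ n : ℕ, ∀ᵐ ω ∂P, ∀ H ∈ Ioo (0 : ℝ) 1, ∀ t : ℝ, 0 ≤ t →
      Tendsto (fun Δ : ℝ => (pwzField B n (H + Δ) t ω - pwzField B n H t ω) / Δ) (𝓝[≠] 0)
        (𝓝 (pwzField B (n + 1) H t ω))) ∧
    (∀ᵐ ω ∂P, ∀ t : ℝ, 0 ≤ t →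
      ContDiffOn ℝ ((⊤ : ℕ∞) : WithTop ℕ∞) (fun H => pwzField B 0 H t ω) (Ioo 0 1) ∧
      ∀ n : ℕ, ∀ H ∈ Ioo (0 : ℝ) 1,
        iteratedDeriv n (fun h => pwzField B 0 h t ω) H = pwzField B n H t ω) := by

  have hreg := hB.ae_isRegularPath
  refine ⟨fun n => ?_, fun n => ?_, ?_⟩
  · filter_upwards [hreg] with ω ⟨hf, hb⟩ H hH t ht
    exact pwzWellDefined_of_isRegularPath hf hb n hH ht
  · filter_upwards [hreg] with ω ⟨hf, hb⟩ H hH t ht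
    simpa [div_eq_inv_mul] using (hasDerivAt_pwzField hf hb n hH ht).tendsto_slope_zero
  · filter_upwards [hreg] with ω ⟨hf, hb⟩ t ht
    exact contDiffOn_and_iteratedDeriv_of_hasDerivAt_succ (X := fun n h => pwzField B n h t ω)
      isOpen_Ioo fun n H hH => hasDerivAt_pwzField hf hb n hH ht
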